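/- Let $X_1,X_2,\dots$ be i.i.d. real random variables such that, for some real $b$, $$\frac1n\sum_{i=1}^n X_i-b\log n\ \xrightarrow{d}\ Z\qquad(n\to\infty),$$ where $Z$ is a $1$-stable random variable, i.e. $Z$ is non-degenerate and for every $n\ge1$ there is a real $c_n$ such that the sum of $n$ independent copies of $Z$ has the same distribution as $nZ+c_n$. Let $Y\ge0$ be a random variable with $\mathbb E(Y\log Y)<\infty$ (with $0\log0=0$), and let $Y_1,Y_2,\dots$ be independent copies of $Y$ that are independent of $(X_i)_{i\ge1}$. Then $\mathbb E Y<\infty$ and, with $\mu=\mathbb E Y$ and $\nu=\mathbb E(Y\log Y)$, $$\frac1n\sum_{i=1}^n X_iY_i-b\mu\log n\ \xrightarrow{d}\ Z':=\mu Z-b(\nu-\mu\log\mu)\qquad(n\to\infty).$$ Moreover, there are real $\kappa>0$ and $\lambda$ such that $Z$ has the characteristic function $$\varphi_Z(t)=\exp\bigl(-(\kappa-\mathrm i\lambda)t-\mathrm i bt\log t\bigr),\qquad t>0,$$ and then $Z'$ has the characteristic function $$\varphi_{Z'}(t)=\exp\bigl(-(\mu\kappa+\mathrm i(b\nu-\mu\lambda))t-\mathrm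 i b\mu t\log t\bigr),\qquad t>0.$$ Finally, for $\gamma>0$, $-1\le\beta\le1$ and $\delta\in\mathbb R$, let $S_1(\gamma,\beta,\delta)$ denote the distribution with characteristic function $$\exp\Bigl(-\gamma|t|\bigl(1+\mathrm i\beta\tfrac2\pi\operatorname{sgn}(t)\log|t|\bigr)+\mathrm i\delta t\Bigr),\qquad t\in\mathbb R$$ (with the value $1$ at $t=0$). If $Z\sim S_1(\gamma,\beta,\delta)$ and $\mu>0$ (that is, $Y$ is not almost surely $0$), then $Z'\sim S_1(\mu\gamma,\beta,\mu\delta-b\nu)$. -/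

import Mathlib

open MeasureTheory ProbabilityTheory Filter

/-- `nu` satisfies the stability relation with norming sequences `a`, `c`: it is a non-degenerate
probability law, and for every `n ≥ 1` we have `a n > 0` and the sum of `n` i.i.d. variables with
law `nu` has the law of `a n * X + c n`, where `X` has law `nu`. -/
def StableWith (nu : Measure ℝ) (a c : ℕ → ℝ) : Prop :=
  IsProbabilityMeasure nu ∧ (∀ x : ℝ, nu ≠ Measure.dirac x) ∧
    ∀ n : ℕ, 1 ≤ n → 0 < a n ∧
      (Measure.pi (fun _ : Fin n => nu)).map (fun x => ∑ i, x i) =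
        nu.map (fun x => a n * x + c n)

/-- A law is `α`-stable (`0 < α ≤ 2`) if it satisfies the stability relation with
scale constants `a n = n ^ (1 / α)`. -/
def IsStableLaw (α : ℝ) (nu : Measure ℝ) : Prop :=
  0 < α ∧ α ≤ 2 ∧
    ∃ a c : ℕ → ℝ, StableWith nu a c ∧ ∀ n : ℕ, 1 ≤ n → a n = (n : ℝ) ^ (1 / α)

/-- `nu` is the stable distribution `S₁(γ, β, δ)`, with `γ > 0` and `-1 ≤ β ≤ 1`: the probability
law with characteristic function `exp (-γ|t| (1 + i β (2/π) sgn(t) log|t|) + i δ t)`. -/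
def IsS1Law (nu : Measure ℝ) (γ β δ : ℝ) : Prop :=
  IsProbabilityMeasure nu ∧ 0 < γ ∧ -1 ≤ β ∧ β ≤ 1 ∧
    ∀ t : ℝ, charFun nu t =
      Complex.exp (-((γ * |t| : ℝ) : ℂ) *
          (1 + Complex.I * ((β * (2 / Real.pi) * Real.sign t * Real.log |t| : ℝ) : ℂ))
        + Complex.I * ((δ * t : ℝ) : ℂ))

/-- `nu` has characteristic function `exp (-(κ - i l) t - i b t log t)` for `t > 0`
(the values for `t < 0` are the complex conjugates). -/
def HasOneStableCharFun (nu : Measure ℝ) (κ l b : ℝ) : Prop :=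
  ∀ t : ℝ, 0 < t → charFun nu t =
    Complex.exp (-((κ : ℂ) - Complex.I * (l : ℂ)) * (t : ℂ)
      - Complex.I * ((b * t * Real.log t : ℝ) : ℂ))

open scoped Topology

/-!
Write `φ` for the characteristic function of `X 0` and `f` for that of `Z`. Everything is read off
from the behaviour of `φ` near `0`.

*Form of the limit.* Comparing the hypothesis along `n` and along `k * n` gives
`f t = f (t / k) ^ k * exp (-i b t log k)`, so that `f t * exp (i b t log t)` turns multiplication
of the argument by a natural number into a power; by continuity it is `exp (-w t)` for `t ≥ 0`
(`exists_one_stable_form`). The modulus bound gives `0 ≤ Re w`, and `Re w = 0` would make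
`|f| = 1` identically and `Z` constant (`exists_eq_dirac_of_norm_charFun_eq_one`).

*Expansion of `φ`.* The hypothesis says
`φ (t / n) ^ n * exp (-i b t log n) → exp (-w t - i b t log t)`, and by Slutsky's theorem this
convergence is uniform on `[0, 1]`. Lifting along paths that start at `t = 0` removes the `2πi`
ambiguity of the logarithm (`Complex.log_exp_eq_of_continuousOn`), and the choice `n = ⌊1 / s⌋`,
`t = n s` gives `log φ(s) = -w s - i b s log s + o(s)`, hence the same expansion of `φ s - 1` as
`s → 0+` (`isLittleO_sub_one_add`).

*The products.* By independence, the characteristic function of `X Y` at `t / n` is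
`E φ(t Y / n)`. The remainder in the expansion of `φ` is dominated by a multiple of
`s (1 + |log y|)` for `s ≤ y`, so dominated convergence with `E |Y log Y| < ∞` gives
`n (E φ(t Y / n) - 1) = -w t μ - i b (t ν + μ t log t - μ t log n) + o(1)`
(`tendsto_natCast_mul_integral_sub_one`). Its modulus is `O(log n)`, so the quadratic term of the
logarithm is negligible in the `n`-th power (`tendsto_pow_mul_exp_of_tendsto`), and Lévy's
theorem finishes the proof.
-/

/-! ### Characteristic functions of means and of products -/

lemma charFun_map_mean_sub_const {Ω : Type*} [MeasurableSpace Ω] {P : Measure Ω}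
    [IsProbabilityMeasure P] {W : ℕ → Ω → ℝ} (hm : ∀ i, Measurable (W i))
    (hind : iIndepFun W P) (hid : ∀ i, IdentDistrib (W i) (W 0) P P) (n : ℕ) (c t : ℝ) :
    charFun (P.map fun ω => (n : ℝ)⁻¹ * ∑ i ∈ Finset.range n, W i ω - c) t =
      charFun (P.map (W 0)) (t / n) ^ n * Complex.exp (-(Complex.I * (t * c : ℝ))) := by
  have hS : Measurable fun ω => ∑ i ∈ Finset.range n, W i ω :=
    Finset.measurable_fun_sum _ fun i _ => hm i
  have h1 : (P.map fun ω => (n : ℝ)⁻¹ * ∑ i ∈ Finset.range n, W i ω - c) =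
      (P.map fun ω => (n : ℝ)⁻¹ * ∑ i ∈ Finset.range n, W i ω).map (· + -c) := by
    rw [Measure.map_map (by fun_prop) (by fun_prop)]
    rfl
  rw [h1, charFun_map_add_const, charFun_map_mul_comp hS.aemeasurable,
    (hind.restrict _).charFun_map_fun_finsetSum_eq_prod fun i _ => (hm i).aemeasurable]
  simp only [fun i => (hid i).map_eq, Finset.prod_const, Finset.card_range, Pi.pow_apply]
  congr 2
  · ring_nf
  · simp; ring

/-- If two families of real variables are each independent, and are independent of each other as
processes, then their termwise products are independent. -/
lemma iIndepFun.mul_of_indepFun {Ω : Type*} [MeasurableSpace Ω] {P : Measure Ω}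
    [IsProbabilityMeasure P] {X Y : ℕ → Ω → ℝ}
    (hXm : ∀ i, Measurable (X i)) (hXind : iIndepFun X P)
    (hYm : ∀ i, Measurable (Y i)) (hYind : iIndepFun Y P)
    (hXY : IndepFun (fun ω i => X i ω) (fun ω i => Y i ω) P) :
    iIndepFun (fun i ω => X i ω * Y i ω) P := by
  rw [iIndepFun_iff_finset]
  intro s
  have hpair : iIndepFun (fun (i : s) ω => (X i ω, Y i ω)) P := by
    rw [iIndepFun_iff_map_fun_eq_pi_map fun i : s => ((hXm i).prodMk (hYm i)).aemeasurable]
    have hUV : IndepFun (fun ω (i : s) => X i ω) (fun ω (i : s) => Y i ω) P :=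
      hXY.comp (φ := fun (f : ℕ → ℝ) (i : s) => f i) (ψ := fun (f : ℕ → ℝ) (i : s) => f i)
        (by fun_prop) (by fun_prop)
    have hU : Measurable fun ω (i : s) => X i ω := by fun_prop
    have hV : Measurable fun ω (i : s) => Y i ω := by fun_prop
    have hlaw := (indepFun_iff_map_prod_eq_prod_map_map hU.aemeasurable hV.aemeasurable).1 hUV
    rw [(iIndepFun_iff_map_fun_eq_pi_map fun i : s => (hXm i).aemeasurable).1 (hXind.restrict s),
      (iIndepFun_iff_map_fun_eq_pi_map fun i : s => (hYm i).aemeasurable).1 (hYind.restrict s)]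
      at hlaw
    have hp : ∀ i : s, P.map (fun ω => (X i ω, Y i ω)) = (P.map (X i)).prod (P.map (Y i)) :=
      fun i => (indepFun_iff_map_prod_eq_prod_map_map (hXm i).aemeasurable
        (hYm i).aemeasurable).1
        (hXY.comp (φ := fun f : ℕ → ℝ => f i) (ψ := fun f : ℕ → ℝ => f i)
          (by fun_prop) (by fun_prop))
    simp_rw [hp]
    have hX (i : s) : IsProbabilityMeasure (P.map (X i)) :=
      Measure.isProbabilityMeasure_map (hXm i).aemeasurable
    have hY (i : s) : IsProbabilityMeasure (P.map (Y i)) :=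
      Measure.isProbabilityMeasure_map (hYm i).aemeasurable
    -- A product of two finite product measures is the product of the pairwise products, after
    -- regrouping the coordinates.
    rw [← ((measurePreserving_arrowProdEquivProdArrow ℝ ℝ s _ _).symm _).map_eq, ← hlaw,
      Measure.map_map (MeasurableEquiv.measurable _) (hU.prodMk hV)]
    rfl
  exact hpair.comp (fun _ p => p.1 * p.2) fun _ => by fun_prop

lemma charFun_map_mul_eq_integral {Ω : Type*} [MeasurableSpace Ω] {P : Measure Ω}
    [IsProbabilityMeasure P] {X Y : Ω → ℝ} (hX : Measurable X) (hY : Measurable Y)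
    (hXY : IndepFun X Y P) (t : ℝ) :
    charFun (P.map fun ω => X ω * Y ω) t = ∫ ω, charFun (P.map X) (t * Y ω) ∂P := by
  have : IsProbabilityMeasure (P.map X) := Measure.isProbabilityMeasure_map hX.aemeasurable
  have : IsProbabilityMeasure (P.map Y) := Measure.isProbabilityMeasure_map hY.aemeasurable
  have h1 : (P.map fun ω => X ω * Y ω) =
      ((P.map X).prod (P.map Y)).map fun p => p.1 * p.2 := by
    rw [← (indepFun_iff_map_prod_eq_prod_map_map hX.aemeasurable hY.aemeasurable).1 hXY,
      Measure.map_map (by fun_prop) (by fun_prop)]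
    rfl
  have hint : Integrable (fun p : ℝ × ℝ => Complex.exp (t * (p.1 * p.2 : ℝ) * Complex.I))
      ((P.map X).prod (P.map Y)) := by
    refine Integrable.of_bound (by fun_prop) 1 (ae_of_all _ fun p => ?_)
    rw [← Complex.ofReal_mul, Complex.norm_exp_ofReal_mul_I]
  rw [h1, charFun_apply_real, integral_map (by fun_prop) (by fun_prop),
    integral_prod_symm _ hint,
    integral_map hY.aemeasurable hint.integral_prod_right.aestronglyMeasurable]
  simp_rw [charFun_apply_real]
  congr 1 with ω
  congr 1 with x
  push_cast
  ring_nf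

/-- Convergence in distribution makes the characteristic functions converge jointly in the index
and the argument, hence locally uniformly. This is Slutsky's theorem with a deterministic factor. -/
lemma tendsto_charFun_atTop_prod_nhds {Ω : Type*} [MeasurableSpace Ω] {P : Measure Ω}
    [IsProbabilityMeasure P] {Ω' : Type*} [MeasurableSpace Ω'] {P' : Measure Ω'}
    [IsProbabilityMeasure P'] {A : ℕ → Ω → ℝ} {Z : Ω' → ℝ}
    (h : TendstoInDistribution A atTop Z (fun _ => P) P') (t : ℝ) :
    Tendsto (fun p : ℕ × ℝ => charFun (P.map (A p.1)) p.2) (atTop ×ˢ 𝓝 t)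
      (𝓝 (charFun (P'.map Z) t)) := by
  have hA : TendstoInDistribution (fun (p : ℕ × ℝ) => A p.1) (atTop ×ˢ 𝓝 t) Z (fun _ => P) P' :=
    ⟨fun p => h.forall_aemeasurable p.1, h.aemeasurable_limit, h.tendsto.comp tendsto_fst⟩
  have hT : TendstoInMeasure P (fun (p : ℕ × ℝ) (_ : Ω) => p.2) (atTop ×ˢ 𝓝 t) fun _ => t := by
    rw [tendstoInMeasure_iff_norm]
    intro ε hε
    refine tendsto_const_nhds.congr' ?_
    filter_upwards [tendsto_snd.eventually (Metric.ball_mem_nhds t hε)] with p hp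
    have hp : |p.2 - t| < ε := hp
    simp [not_le.2 hp]
  have h1 := (hA.continuous_comp_prodMk_of_tendstoInMeasure_const
    (g := fun p : ℝ × ℝ => p.2 * p.1) (by fun_prop) hT fun _ => by fun_prop).tendsto
  have h2 := (ProbabilityMeasure.tendsto_iff_forall_integral_rclike_tendsto ℂ).1 h1
    (BoundedContinuousFunction.innerProbChar 1)
  simp only [ProbabilityMeasure.coe_mk, ← charFun_eq_integral_innerProbChar] at h2
  rw [charFun_map_mul_comp h.aemeasurable_limit] at h2
  simpa [charFun_map_mul_comp (h.forall_aemeasurable _)] using h2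

/-! ### Logarithms along paths and the form of a 1-stable characteristic function -/

/-- A path `D` from `0` whose exponential stays within distance `1` of `1` is the principal
logarithm of its exponential: the difference is a continuous function with values in `2πiℤ`. -/
lemma Complex.log_exp_eq_of_continuousOn {D : ℝ → ℂ} {T : ℝ} (hD : ContinuousOn D (Set.Icc 0 T))
    (h0 : D 0 = 0) (h : ∀ t ∈ Set.Icc 0 T, ‖Complex.exp (D t) - 1‖ < 1) {t : ℝ}
    (ht : t ∈ Set.Icc 0 T) : Complex.log (Complex.exp (D t)) = D t := by
  have hslit : ∀ t ∈ Set.Icc 0 T, Complex.exp (D t) ∈ Complex.slitPlane := fun t ht => by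
    simpa using Complex.mem_slitPlane_of_norm_lt_one (h t ht)
  -- The winding number: continuous and integer-valued, hence constant.
  set g : ℝ → ℝ := fun t =>
    ((D t - Complex.log (Complex.exp (D t))) / (2 * Real.pi * Complex.I)).re with hg
  have hgc : ContinuousOn g (Set.Icc 0 T) :=
    Complex.continuous_re.comp_continuousOn
      ((hD.sub ((Complex.continuous_exp.comp_continuousOn hD).clog hslit)).div_const _)
  have hint (t : ℝ) : ∃ n : ℤ, D t - Complex.log (Complex.exp (D t)) =
      n * (2 * Real.pi * Complex.I) := by
    obtain ⟨n, hn⟩ := Complex.exp_eq_exp_iff_exists_int.1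
      (Complex.exp_log (Complex.exp_ne_zero (D t))).symm
    exact ⟨n, by linear_combination hn⟩
  have hne : (2 * Real.pi * Complex.I : ℂ) ≠ 0 := Complex.two_pi_I_ne_zero
  have hgn {t : ℝ} {n : ℤ} (hn : D t - Complex.log (Complex.exp (D t)) =
      n * (2 * Real.pi * Complex.I)) : g t = n := by
    rw [hg]
    simp only [hn, mul_div_cancel_right₀ _ hne]
    simp
  have hmaps : Set.MapsTo g (Set.Icc 0 T) (Set.range ((↑) : ℤ → ℝ)) := fun t _ => by
    obtain ⟨n, hn⟩ := hint t
    exact ⟨n, (hgn hn).symm⟩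
  have hconst : g t = g 0 := isPreconnected_Icc.constant_of_mapsTo
    Int.isClosedEmbedding_coe_real.isInducing.isDiscrete_range hgc hmaps ht
      ⟨le_rfl, ht.1.trans ht.2⟩
  obtain ⟨n, hn⟩ := hint t
  have hn0 : (n : ℝ) = 0 := by
    rw [← hgn hn, hconst, hg]
    simp [h0]
  have : n = 0 := by exact_mod_cast hn0
  rw [this] at hn
  simp only [Int.cast_zero, zero_mul] at hn
  exact (sub_eq_zero.1 hn).symm

/-- A continuous function on `[0, ∞)` that turns multiplication of the argument by natural numbers
into powers is an exponential. -/
lemma exists_eq_exp_mul_of_map_nat_mul {f : ℝ → ℂ} (hf : Continuous f) (h0 : f 0 = 1)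
    (h : ∀ k : ℕ, k ≠ 0 → ∀ t, 0 ≤ t → f (k * t) = f t ^ k) :
    ∃ w : ℂ, ∀ t, 0 ≤ t → f t = Complex.exp (w * t) := by
  obtain ⟨δ, hδ, hball⟩ := Metric.continuousAt_iff.1 hf.continuousAt (1 : ℝ) one_pos
  rw [h0] at hball
  set d := δ / 2 with hd
  have hdpos : 0 < d := by positivity
  have hnear : ∀ t ∈ Set.Icc 0 d, ‖f t - 1‖ < 1 := fun t ht => by
    rw [← dist_eq_norm]
    apply hball
    rw [Real.dist_eq, sub_zero, abs_of_nonneg ht.1]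
    linarith [ht.2]
  have hslit : ∀ t ∈ Set.Icc 0 d, f t ∈ Complex.slitPlane := fun t ht => by
    simpa using Complex.mem_slitPlane_of_norm_lt_one (hnear t ht)
  have hlc : ContinuousOn (fun t => Complex.log (f t)) (Set.Icc 0 d) := hf.continuousOn.clog hslit
  have hel : ∀ t ∈ Set.Icc 0 d, Complex.exp (Complex.log (f t)) = f t := fun t ht =>
    Complex.exp_log (Complex.slitPlane_ne_zero (hslit t ht))
  -- The two logarithms agree up to `2πiℤ`, and both vanish at `0`, so they agree on `[0, d]`.
  have hlog (k : ℕ) (hk : k ≠ 0) : k * Complex.log (f (d / k)) = Complex.log (f d) := by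
    have hk1 : (1 : ℝ) ≤ k := by exact_mod_cast Nat.one_le_iff_ne_zero.2 hk
    have hmaps : Set.MapsTo (fun t : ℝ => t / k) (Set.Icc 0 d) (Set.Icc 0 d) := fun t ht =>
      ⟨div_nonneg ht.1 (by positivity), (div_le_self ht.1 hk1).trans ht.2⟩
    have hexp : ∀ t ∈ Set.Icc 0 d,
        Complex.exp (k * Complex.log (f (t / k)) - Complex.log (f t)) = 1 := fun t ht => by
      have : f t = f (t / k) ^ k := by
        rw [← h k hk _ (hmaps ht).1]
        congr 1
        field_simp
      rw [Complex.exp_sub, Complex.exp_nat_mul, hel _ (hmaps ht), hel t ht, ← this,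
        div_self (Complex.slitPlane_ne_zero (hslit t ht))]
    have := Complex.log_exp_eq_of_continuousOn (T := d)
      (D := fun t => k * Complex.log (f (t / k)) - Complex.log (f t))
      ((continuousOn_const.mul (hlc.comp (by fun_prop) hmaps)).sub hlc) (by simp [h0])
      (fun t ht => by simp [hexp t ht]) (t := d) ⟨hdpos.le, le_rfl⟩
    rw [hexp d ⟨hdpos.le, le_rfl⟩, Complex.log_one] at this
    exact (sub_eq_zero.1 this.symm)
  refine ⟨Complex.log (f d) / d, fun t ht => ?_⟩
  -- Approximate `t` by multiples of `d / k`, where the formula is an identity of powers.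
  have hlim : Tendsto (fun k : ℕ => ((⌊t / d * k⌋₊ : ℝ) / k) * d) atTop (𝓝 t) := by
    have := ((tendsto_nat_floor_mul_div_atTop (div_nonneg ht hdpos.le)).comp
      tendsto_natCast_atTop_atTop).mul_const d
    rwa [div_mul_cancel₀ _ hdpos.ne'] at this
  have h1 := (hf.tendsto t).comp hlim
  have hc : Continuous fun x : ℝ => Complex.exp (Complex.log (f d) / d * x) := by fun_prop
  have h2 := (hc.tendsto t).comp hlim
  refine tendsto_nhds_unique (h1.congr' ?_) h2
  filter_upwards [eventually_ne_atTop 0] with k hk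
  have hk0 : (k : ℂ) ≠ 0 := by exact_mod_cast hk
  have hk1 : (1 : ℝ) ≤ k := by exact_mod_cast Nat.one_le_iff_ne_zero.2 hk
  have hd0 : (d : ℂ) ≠ 0 := by exact_mod_cast hdpos.ne'
  have hmem : d / k ∈ Set.Icc 0 d := ⟨by positivity, div_le_self hdpos.le hk1⟩
  simp only [Function.comp]
  set p := ⌊t / d * k⌋₊
  rcases eq_or_ne p 0 with hp | hp
  · simp [hp, h0]
  rw [show (p : ℝ) / k * d = p * (d / k) by ring, h p hp _ hmem.1, ← hel _ hmem,
    ← Complex.exp_nat_mul, ← hlog k hk]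
  congr 1
  push_cast
  field_simp

/-- The functional equation `f t = f (t / k) ^ k * exp (-i b t log k)` determines `f` on `[0, ∞)` up
to one complex constant. -/
lemma exists_one_stable_form {f : ℝ → ℂ} {b : ℝ} (hf : Continuous f) (h0 : f 0 = 1)
    (h : ∀ k : ℕ, k ≠ 0 → ∀ t, 0 ≤ t →
      f t = f (t / k) ^ k * Complex.exp (-(Complex.I * (t * (b * Real.log k) : ℝ)))) :
    ∃ w : ℂ, ∀ t, 0 ≤ t →
      f t = Complex.exp (-w * t - Complex.I * (b * t * Real.log t : ℝ)) := by
  have hg : Continuous fun t : ℝ => f t * Complex.exp (Complex.I * (b * (t * Real.log t) : ℝ)) := by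
    have := Real.continuous_mul_log
    fun_prop
  obtain ⟨w, hw⟩ := exists_eq_exp_mul_of_map_nat_mul hg (by simp [h0]) fun k hk t ht => by
    have hk0 : (k : ℝ) ≠ 0 := by exact_mod_cast hk
    rw [h k hk (k * t) (by positivity), mul_div_cancel_left₀ _ hk0, mul_pow, ← Complex.exp_nat_mul,
      mul_assoc, ← Complex.exp_add]
    congr 2
    rcases ht.eq_or_lt with rfl | ht
    · simp
    rw [Real.log_mul hk0 ht.ne']
    push_cast
    ring
  refine ⟨-w, fun t ht => ?_⟩
  rw [Complex.exp_sub, eq_div_iff (Complex.exp_ne_zero _), neg_neg, ← hw t ht]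
  simp only [mul_assoc]

/-! ### Expansion of a characteristic function at the origin -/

/-- Joint convergence at every point of a compact set is uniform convergence on it. -/
lemma eventually_forall_norm_sub_lt_of_tendsto_prod {K : Set ℝ} (hK : IsCompact K)
    {G : ℕ → ℝ → ℂ} {c : ℂ}
    (h : ∀ t ∈ K, Tendsto (fun p : ℕ × ℝ => G p.1 p.2) (atTop ×ˢ 𝓝 t) (𝓝 c)) {ε : ℝ}
    (hε : 0 < ε) : ∀ᶠ n in atTop, ∀ t ∈ K, ‖G n t - c‖ < ε := by
  have hloc : TendstoLocallyUniformlyOn G (fun _ => c) atTop K :=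
    tendstoLocallyUniformlyOn_iff_forall_tendsto.2 fun t ht =>
      Uniform.tendsto_nhds_right.1
        ((h t ht).mono_left (prod_mono_right _ nhdsWithin_le_nhds))
  have hunif := (tendstoLocallyUniformlyOn_iff_tendstoUniformlyOn_of_compact hK).1 hloc
  filter_upwards [Metric.tendstoUniformlyOn_iff.1 hunif ε hε] with n hn t ht
  rw [← dist_eq_norm, dist_comm]
  exact hn t ht

/-- Logarithmic form of the convergence of `φ (t / n) ^ n`, uniformly in `t ∈ [0, 1]` and without
the `2πi` ambiguity. -/
lemma eventually_forall_norm_log_add_lt {φ : ℝ → ℂ} {b : ℝ} {w : ℂ} (hφ : Continuous φ)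
    (h0 : φ 0 = 1)
    (h : ∀ t ∈ Set.Icc (0 : ℝ) 1, Tendsto (fun p : ℕ × ℝ =>
      φ (p.2 / p.1) ^ p.1 * Complex.exp (-(Complex.I * (p.2 * (b * Real.log p.1) : ℝ))))
      (atTop ×ˢ 𝓝 t) (𝓝 (Complex.exp (-w * t - Complex.I * (b * t * Real.log t : ℝ)))))
    {ε : ℝ} (hε : 0 < ε) :
    ∀ᶠ n : ℕ in atTop, ∀ t ∈ Set.Icc (0 : ℝ) 1,
      ‖n * Complex.log (φ (t / n)) - Complex.I * (t * (b * Real.log n) : ℝ)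
        + w * t + Complex.I * (b * t * Real.log t : ℝ)‖ < ε := by
  have htl : Continuous fun t : ℝ => w * t + Complex.I * (b * t * Real.log t : ℝ) := by
    have := Real.continuous_mul_log
    simp only [mul_assoc]
    fun_prop
  obtain ⟨δ, hδ, hball⟩ := Metric.continuousAt_iff.1 hφ.continuousAt (1 : ℝ) one_pos
  rw [h0] at hball
  have hlog1 : ContinuousAt Complex.log 1 := continuousAt_clog (by simp)
  obtain ⟨η, hη, hlogη⟩ := Metric.continuousAt_iff.1 hlog1 ε hε
  -- Dividing by the nonvanishing limit makes the target the constant `1`.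
  have hunif := eventually_forall_norm_sub_lt_of_tendsto_prod
    (isCompact_Icc (a := (0 : ℝ)) (b := 1))
    (G := fun n t => φ (t / n) ^ n * Complex.exp (-(Complex.I * (t * (b * Real.log n) : ℝ))) *
      Complex.exp (w * t + Complex.I * (b * t * Real.log t : ℝ))) (c := 1)
    (fun t ht => by
      have := (h t ht).mul (((Complex.continuous_exp.comp htl).tendsto t).comp
        (tendsto_snd (f := (atTop : Filter ℕ))))
      rw [Function.comp, ← Complex.exp_add] at this
      convert! this using 2
      ring_nf
      simp) (lt_min hη one_pos)
  -- For `n > 1 / δ` all `t / n` with `t ≤ 1` lie where `φ` avoids the cut of the logarithm.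
  have hlarge : ∀ᶠ n : ℕ in atTop, 1 / δ < n :=
    tendsto_natCast_atTop_atTop.eventually (eventually_gt_atTop _)
  filter_upwards [hunif, hlarge, eventually_ge_atTop 1] with n hn hnδ hn1
  have hnpos : (0 : ℝ) < n := by exact_mod_cast hn1
  have hslit : ∀ t ∈ Set.Icc (0 : ℝ) 1, φ (t / n) ∈ Complex.slitPlane := fun t ht => by
    have : ‖φ (t / n) - 1‖ < 1 := by
      rw [← dist_eq_norm]
      apply hball
      rw [Real.dist_eq, sub_zero, abs_of_nonneg (div_nonneg ht.1 hnpos.le), div_lt_iff₀ hnpos]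
      rw [div_lt_iff₀ hδ, mul_comm] at hnδ
      linarith [ht.2]
    simpa using Complex.mem_slitPlane_of_norm_lt_one this
  set D : ℝ → ℂ := fun t => n * Complex.log (φ (t / n)) - Complex.I * (t * (b * Real.log n) : ℝ)
        + w * t + Complex.I * (b * t * Real.log t : ℝ) with hD
  have hDc : ContinuousOn D (Set.Icc 0 1) := by
    have h1 : ContinuousOn (fun t : ℝ => Complex.log (φ (t / n))) (Set.Icc 0 1) :=
      ContinuousOn.clog (by fun_prop) hslit
    have h2 : Continuous fun t : ℝ => Complex.I * (t * (b * Real.log n) : ℝ) := by fun_prop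
    refine ((((continuousOn_const (c := (n : ℂ))).mul h1).sub h2.continuousOn).add
      htl.continuousOn).congr ?_
    intro t _
    simp only [hD, add_assoc]
    rfl
  have hexp : ∀ t ∈ Set.Icc (0 : ℝ) 1, ‖Complex.exp (D t) - 1‖ < min η 1 := fun t ht => by
    have := hn t ht
    rwa [← Complex.exp_log (Complex.slitPlane_ne_zero (hslit t ht)), ← Complex.exp_nat_mul,
      ← Complex.exp_add, ← Complex.exp_add, ← sub_eq_add_neg, ← add_assoc] at this
  intro t ht
  change ‖D t‖ < ε
  rw [← Complex.log_exp_eq_of_continuousOn hDc (by simp [hD, h0])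
    (fun t ht => (hexp t ht).trans_le (min_le_right _ _)) ht]
  have := hlogη (x := Complex.exp (D t)) (by
    rw [dist_eq_norm]
    exact (hexp t ht).trans_le (min_le_left _ _))
  rwa [Complex.log_one, dist_zero_right] at this

/-- Expansion of `log ∘ φ` at `0+`, from the uniform convergence evaluated at `n = ⌊1 / s⌋` and
`t = n s ∈ [1 / 2, 1]`. -/
lemma isLittleO_log_add {φ : ℝ → ℂ} {b : ℝ} {w : ℂ} (hφ : Continuous φ)
    (h0 : φ 0 = 1)
    (h : ∀ t ∈ Set.Icc (0 : ℝ) 1, Tendsto (fun p : ℕ × ℝ =>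
      φ (p.2 / p.1) ^ p.1 * Complex.exp (-(Complex.I * (p.2 * (b * Real.log p.1) : ℝ))))
      (atTop ×ˢ 𝓝 t) (𝓝 (Complex.exp (-w * t - Complex.I * (b * t * Real.log t : ℝ))))) :
    (fun s : ℝ => Complex.log (φ s) + (w * s + Complex.I * (b * (s * Real.log s) : ℝ)))
      =o[𝓝[>] 0] fun s : ℝ => s := by
  rw [Asymptotics.isLittleO_iff]
  intro ε hε
  have hfloor : Tendsto (fun s : ℝ => ⌊s⁻¹⌋₊) (𝓝[>] 0) atTop :=
    tendsto_nat_floor_atTop.comp tendsto_inv_nhdsGT_zero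
  filter_upwards [hfloor.eventually
    (eventually_forall_norm_log_add_lt hφ h0 h (half_pos hε)), hfloor.eventually
    (eventually_ge_atTop 1), self_mem_nhdsWithin] with s hs hn1 hspos
  rw [Set.mem_Ioi] at hspos
  set n := ⌊s⁻¹⌋₊
  have hnpos : (0 : ℝ) < n := by exact_mod_cast hn1
  have hn1' : (1 : ℝ) ≤ n := by exact_mod_cast hn1
  have hle : n * s ≤ 1 := by
    have := Nat.floor_le (inv_pos.2 hspos).le
    calc (n : ℝ) * s ≤ s⁻¹ * s := by gcongr
      _ = 1 := inv_mul_cancel₀ hspos.ne'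
  -- As `1 / n ≤ 2 s`, an error of size `ε / (2 n)` is at most `ε s`.
  have hge : 1 ≤ 2 * (n * s) := by
    have := (Nat.lt_floor_add_one s⁻¹).le
    have h1 : s⁻¹ * s ≤ (n + 1) * s := by gcongr
    rw [inv_mul_cancel₀ hspos.ne'] at h1
    nlinarith
  have hD := hs (n * s) ⟨by positivity, hle⟩
  rw [mul_div_cancel_left₀ _ hnpos.ne', Real.log_mul hnpos.ne' hspos.ne'] at hD
  have hfactor : n * Complex.log (φ s) - Complex.I * (n * s * (b * Real.log n) : ℝ)
      + w * (n * s : ℝ) + Complex.I * (b * (n * s) * (Real.log n + Real.log s) : ℝ) =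
      n * (Complex.log (φ s) + (w * s + Complex.I * (b * (s * Real.log s) : ℝ))) := by
    push_cast
    ring
  rw [hfactor, norm_mul, Complex.norm_natCast] at hD
  rw [Real.norm_of_nonneg hspos.le]
  set r := ‖Complex.log (φ s) + (w * s + Complex.I * (b * (s * Real.log s) : ℝ))‖
  have hr : 0 ≤ r := norm_nonneg _
  have h2 : n * r ≤ n * (ε * s) := by nlinarith
  exact le_of_mul_le_mul_left h2 hnpos

/-- Expansion `φ s = 1 - w s - i b s log s + o(s)` as `s → 0+`. -/
lemma isLittleO_sub_one_add {φ : ℝ → ℂ} {b : ℝ} {w : ℂ} (hφ : Continuous φ)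
    (h0 : φ 0 = 1)
    (h : ∀ t ∈ Set.Icc (0 : ℝ) 1, Tendsto (fun p : ℕ × ℝ =>
      φ (p.2 / p.1) ^ p.1 * Complex.exp (-(Complex.I * (p.2 * (b * Real.log p.1) : ℝ))))
      (atTop ×ˢ 𝓝 t) (𝓝 (Complex.exp (-w * t - Complex.I * (b * t * Real.log t : ℝ))))) :
    (fun s : ℝ => φ s - 1 + (w * s + Complex.I * (b * (s * Real.log s) : ℝ)))
      =o[𝓝[>] 0] fun s : ℝ => s := by
  have hlog := isLittleO_log_add hφ h0 h
  -- Comparing with `√s` shows that the square of `log φ(s) = O(s |log s|)` is `o(s)`.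
  have hsplit : ∀ᶠ s : ℝ in 𝓝[>] 0, s ^ (1 / 2 : ℝ) * s ^ (1 / 2 : ℝ) = s := by
    filter_upwards [self_mem_nhdsWithin] with s hs
    rw [← Real.rpow_add hs]
    norm_num
  have hroot : Tendsto (fun s : ℝ => s ^ (1 / 2 : ℝ)) (𝓝[>] 0) (𝓝 0) := by
    have := (Real.continuous_rpow_const (q := 1 / 2) (by norm_num)).tendsto 0
    rw [Real.zero_rpow (by norm_num)] at this
    exact this.mono_left nhdsWithin_le_nhds
  have hid : (fun s : ℝ => s) =o[𝓝[>] 0] fun s : ℝ => s ^ (1 / 2 : ℝ) := by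
    refine (((Asymptotics.isLittleO_one_iff ℝ).2 hroot).mul_isBigO
      (Asymptotics.isBigO_refl (fun s : ℝ => s ^ (1 / 2 : ℝ)) _)).congr' hsplit ?_
    simp
  have hmullog : (fun s : ℝ => s * Real.log s) =o[𝓝[>] 0] fun s : ℝ => s ^ (1 / 2 : ℝ) := by
    refine (((Asymptotics.isLittleO_one_iff ℝ).2
      (tendsto_log_mul_rpow_nhdsGT_zero (r := 1 / 2) (by norm_num))).mul_isBigO
      (Asymptotics.isBigO_refl (fun s : ℝ => s ^ (1 / 2 : ℝ)) _)).congr' ?_ ?_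
    · filter_upwards [hsplit] with s hs
      rw [mul_assoc, hs, mul_comm]
    · simp
  have hmain : (fun s : ℝ => w * s + Complex.I * (b * (s * Real.log s) : ℝ))
      =o[𝓝[>] 0] fun s : ℝ => s ^ (1 / 2 : ℝ) := by
    refine .add ((Asymptotics.IsBigO.of_bound ‖w‖ (.of_forall fun s => ?_)).trans_isLittleO hid)
      ((Asymptotics.IsBigO.of_bound |b| (.of_forall fun s => ?_)).trans_isLittleO hmullog)
    · simp
    · simp
  have hl : (fun s : ℝ => Complex.log (φ s)) =o[𝓝[>] 0] fun s : ℝ => s ^ (1 / 2 : ℝ) := by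
    simpa using (hlog.trans hid).sub hmain
  have hsq : (fun s : ℝ => Complex.log (φ s) ^ 2) =o[𝓝[>] 0] fun s : ℝ => s := by
    refine (hl.pow two_pos).congr' (EventuallyEq.refl _ _) ?_
    filter_upwards [self_mem_nhdsWithin] with s hs
    rw [← Real.rpow_natCast, ← Real.rpow_mul (le_of_lt hs)]
    norm_num
  have hφ0 : Tendsto φ (𝓝[>] 0) (𝓝 1) := by
    simpa [h0] using (hφ.tendsto 0).mono_left nhdsWithin_le_nhds
  have hl0 : Tendsto (fun s => Complex.log (φ s)) (𝓝[>] 0) (𝓝 0) := by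
    simpa using hφ0.clog (by simp)
  have hexp : (fun s : ℝ => φ s - 1 - Complex.log (φ s)) =o[𝓝[>] 0] fun s : ℝ => s := by
    refine (Asymptotics.IsBigO.of_bound 1 ?_).trans_isLittleO hsq
    filter_upwards [hl0.eventually (Metric.closedBall_mem_nhds 0 one_pos),
      hφ0.eventually_ne one_ne_zero] with s hs hne
    have := Complex.norm_exp_sub_one_sub_id_le (x := Complex.log (φ s)) (by simpa using hs)
    rw [Complex.exp_log hne] at this
    simpa using this
  exact (hexp.add hlog).congr_left fun s => by ring

/-! ### Averaging the expansion over the multiplier -/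

/-- An `n`-th power limit `(1 + z n) ^ n` in which `n * z n` may grow like `i B log n`: the growth
is compensated by the factor `exp (-i B log n)`. -/
lemma tendsto_pow_mul_exp_of_tendsto {ζ : ℕ → ℂ} {A : ℂ} {B : ℝ}
    (h : Tendsto (fun n : ℕ => n * (ζ n - 1) + A - Complex.I * (B * Real.log n : ℝ)) atTop (𝓝 0)) :
    Tendsto (fun n : ℕ => ζ n ^ n * Complex.exp (-(Complex.I * (B * Real.log n : ℝ)))) atTop
      (𝓝 (Complex.exp (-A))) := by
  have hdiv (k : ℕ) : Tendsto (fun n : ℕ => ((Real.log n ^ k / n : ℝ) : ℂ)) atTop (𝓝 0) := by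
    have := (Real.tendsto_pow_log_div_mul_add_atTop 1 0 k one_ne_zero).comp
      tendsto_natCast_atTop_atTop
    simpa [Function.comp_def] using this.ofReal
  set u : ℕ → ℂ := fun n => n * (ζ n - 1) + A - Complex.I * (B * Real.log n : ℝ) with hu
  have hz0 : Tendsto (fun n => ζ n - 1) atTop (𝓝 0) := by
    have := ((h.sub_const A).mul (hdiv 0)).add ((hdiv 1).const_mul (Complex.I * B))
    simp only [mul_zero, add_zero] at this
    refine this.congr' ?_
    filter_upwards [eventually_ne_atTop 0] with n hn
    have hn0 : (n : ℂ) ≠ 0 := by exact_mod_cast hn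
    simp only [hu]
    push_cast
    field_simp
    ring
  have hsq : Tendsto (fun n : ℕ => n * (ζ n - 1) ^ 2) atTop (𝓝 0) := by
    have := ((((h.sub_const A).pow 2).mul (hdiv 0)).add
      (((h.sub_const A).mul (hdiv 1)).const_mul (2 * Complex.I * B))).add
      ((hdiv 2).const_mul ((Complex.I * B) ^ 2))
    simp only [mul_zero, add_zero] at this
    refine this.congr' ?_
    filter_upwards [eventually_ne_atTop 0] with n hn
    have hn0 : (n : ℂ) ≠ 0 := by exact_mod_cast hn
    simp only [hu]
    push_cast
    field_simp
    ring
  have hrem : Tendsto (fun n : ℕ => n * (Complex.log (ζ n) - (ζ n - 1))) atTop (𝓝 0) := by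
    have := (Asymptotics.isBigO_refl (fun n : ℕ => (n : ℂ)) atTop).mul
      (Complex.log_sub_self_isBigO.comp_tendsto hz0)
    simpa [Function.comp_def] using this.trans_tendsto hsq
  have hlog : Tendsto (fun n : ℕ => n * Complex.log (ζ n) - Complex.I * (B * Real.log n : ℝ))
      atTop (𝓝 (-A)) := by
    have := (hrem.add h).sub_const A
    rw [add_zero, zero_sub] at this
    refine this.congr fun n => ?_
    simp only [hu]
    ring
  refine ((Complex.continuous_exp.tendsto _).comp hlog).congr' ?_
  have hζ : Tendsto ζ atTop (𝓝 1) := by simpa using hz0.add_const 1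
  filter_upwards [hζ.eventually_ne one_ne_zero] with n hn
  rw [Function.comp, sub_eq_add_neg, Complex.exp_add, Complex.exp_nat_mul, Complex.exp_log hn]

lemma Real.le_exp_one_add_abs_mul_log (y : ℝ) : y ≤ Real.exp 1 + |y * Real.log y| := by
  rcases le_total y (Real.exp 1) with h | h
  · exact h.trans (le_add_of_nonneg_right (abs_nonneg _))
  · have hy : 0 < y := (Real.exp_pos 1).trans_le h
    have hl : 1 ≤ Real.log y := (Real.le_log_iff_exp_le hy).2 h
    have := le_abs_self (y * Real.log y)
    nlinarith [Real.exp_pos 1]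

lemma integrable_of_integrable_mul_log {Ω : Type*} [MeasurableSpace Ω] {P : Measure Ω}
    [IsFiniteMeasure P] {Y : Ω → ℝ} (hY : AEStronglyMeasurable Y P) (hY0 : ∀ᵐ ω ∂P, 0 ≤ Y ω)
    (h : Integrable (fun ω => Y ω * Real.log (Y ω)) P) : Integrable Y P := by
  refine ((integrable_const (Real.exp 1)).add h.abs).mono' hY ?_
  filter_upwards [hY0] with ω hω
  rw [Real.norm_of_nonneg hω]
  exact Real.le_exp_one_add_abs_mul_log _

/-- The remainder of the expansion of `φ`, bounded for all `s ≤ y` in terms of `s` and `log y`.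
With `y` fixed this is uniform in `s`, as needed for dominated convergence. -/
lemma exists_norm_remainder_le {φ : ℝ → ℂ} {b : ℝ} {w : ℂ} (h0 : φ 0 = 1) (h1 : ∀ s, ‖φ s‖ ≤ 1)
    (h : (fun s : ℝ => φ s - 1 + (w * s + Complex.I * (b * (s * Real.log s) : ℝ)))
      =o[𝓝[>] 0] fun s : ℝ => s) :
    ∃ C, ∀ s y : ℝ, 0 ≤ s → s ≤ y →
      ‖φ s - 1 + (w * s + Complex.I * (b * (s * Real.log s) : ℝ))‖ ≤
        s * (C + |b| * |Real.log y|) := by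
  obtain ⟨δ, hδ, hsmall⟩ := (mem_nhdsGT_iff_exists_Ioc_subset (α := ℝ)).1
    ((Asymptotics.isLittleO_iff.1 h) one_pos)
  rw [Set.mem_Ioi] at hδ
  refine ⟨1 + 2 / δ + ‖w‖ + |b| * |Real.log δ|, fun s y hs hsy => ?_⟩
  rcases hs.eq_or_lt with rfl | hs
  · simp [h0]
  rcases le_or_gt s δ with hsδ | hsδ
  · have := hsmall ⟨hs, hsδ⟩
    rw [Set.mem_ofPred_eq, one_mul, Real.norm_of_nonneg hs.le] at this
    refine this.trans (le_mul_of_one_le_right hs.le ?_)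
    have : 0 ≤ 2 / δ + ‖w‖ + |b| * |Real.log δ| + |b| * |Real.log y| := by positivity
    linarith
  · have hφ : ‖φ s - 1‖ ≤ s * (2 / δ) := by
      have h2 : ‖φ s - 1‖ ≤ 2 := (norm_sub_le _ _).trans (by simpa using by linarith [h1 s])
      refine h2.trans ?_
      rw [mul_div_assoc', le_div_iff₀ hδ]
      linarith
    have hlog : |Real.log s| ≤ |Real.log δ| + |Real.log y| := by
      have l1 := Real.log_le_log hδ hsδ.le
      have l2 := Real.log_le_log hs hsy
      rw [abs_le]
      constructor
      · linarith [neg_abs_le (Real.log δ), abs_nonneg (Real.log y)]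
      · linarith [le_abs_self (Real.log y), abs_nonneg (Real.log δ)]
    have hw : ‖w * s‖ = s * ‖w‖ := by
      rw [norm_mul, Complex.norm_real, Real.norm_of_nonneg hs.le, mul_comm]
    have hb : ‖Complex.I * (b * (s * Real.log s) : ℝ)‖ ≤
        s * (|b| * (|Real.log δ| + |Real.log y|)) := by
      rw [norm_mul, Complex.norm_I, one_mul, Complex.norm_real, Real.norm_eq_abs, abs_mul, abs_mul,
        abs_of_pos hs]
      calc |b| * (s * |Real.log s|) = s * (|b| * |Real.log s|) := by ring
        _ ≤ _ := by gcongr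
    calc _ ≤ ‖φ s - 1‖ + (‖w * s‖ + ‖Complex.I * (b * (s * Real.log s) : ℝ)‖) :=
          (norm_add_le _ _).trans (by gcongr; exact norm_add_le _ _)
      _ ≤ s * (2 / δ) + (s * ‖w‖ + s * (|b| * (|Real.log δ| + |Real.log y|))) := by
          rw [hw]; gcongr
      _ ≤ _ := by nlinarith

lemma mul_log_div_mul {t y : ℝ} (ht : 0 < t) {n : ℕ} (hn : n ≠ 0) :
    n * (t / n * y * Real.log (t / n * y)) =
      t * (y * Real.log y) + (t * Real.log t - t * Real.log n) * y := by
  have hn0 : (n : ℝ) ≠ 0 := by exact_mod_cast hn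
  rcases eq_or_ne y 0 with rfl | hy
  · simp
  rw [Real.log_mul (by positivity) hy, Real.log_div ht.ne' hn0]
  field_simp
  ring

/-- The expansion of `φ` integrated against the law of `Y` at scale `t / n`. -/
lemma tendsto_natCast_mul_integral_sub_one {Ω : Type*} [MeasurableSpace Ω] {P : Measure Ω}
    [IsProbabilityMeasure P] {Y : Ω → ℝ} (hY : Measurable Y) (hY0 : ∀ᵐ ω ∂P, 0 ≤ Y ω)
    (hYlog : Integrable (fun ω => Y ω * Real.log (Y ω)) P)
    {φ : ℝ → ℂ} {b : ℝ} {w : ℂ} (hφ : Continuous φ) (h0 : φ 0 = 1) (h1 : ∀ s, ‖φ s‖ ≤ 1)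
    (h : (fun s : ℝ => φ s - 1 + (w * s + Complex.I * (b * (s * Real.log s) : ℝ)))
      =o[𝓝[>] 0] fun s : ℝ => s) {t : ℝ} (ht : 0 < t) :
    Tendsto (fun n : ℕ => n * (∫ ω, φ (t / n * Y ω) ∂P - 1) +
      (w * (t * ∫ ω, Y ω ∂P : ℝ) + Complex.I * (b * (t * ∫ ω, Y ω * Real.log (Y ω) ∂P
        + t * Real.log t * ∫ ω, Y ω ∂P) : ℝ))
      - Complex.I * (b * t * (∫ ω, Y ω ∂P) * Real.log n : ℝ)) atTop (𝓝 0) := by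
  have hYi := integrable_of_integrable_mul_log hY.aestronglyMeasurable hY0 hYlog
  obtain ⟨C, hC⟩ := exists_norm_remainder_le h0 h1 h
  set ρ : ℝ → ℂ := fun s => φ s - 1 + (w * s + Complex.I * (b * (s * Real.log s) : ℝ)) with hρ
  have hρm : Measurable ρ := by
    have := Real.measurable_log
    have := hφ.measurable
    fun_prop
  -- Dominated convergence for the remainder; the dominating function is a combination of `Y` and
  -- `|Y log Y|`.
  have hlim : Tendsto (fun n : ℕ => ∫ ω, n * ρ (t / n * Y ω) ∂P) atTop (𝓝 (∫ _, 0 ∂P)) := by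
    refine tendsto_integral_filter_of_dominated_convergence
      (fun ω => t * Y ω * (C + |b| * |Real.log (t * Y ω)|)) ?_ ?_ ?_ ?_
    · exact .of_forall fun n => by
        have : Measurable fun ω => n * ρ (t / n * Y ω) := by fun_prop
        exact this.aestronglyMeasurable
    · filter_upwards [eventually_ge_atTop 1] with n hn
      filter_upwards [hY0] with ω hω
      have hn1 : (1 : ℝ) ≤ n := by exact_mod_cast hn
      have hle : t / n * Y ω ≤ t * Y ω := by
        gcongr
        exact div_le_self ht.le hn1
      have := hC (t / n * Y ω) (t * Y ω) (by positivity) hle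
      rw [norm_mul, Complex.norm_natCast]
      calc n * ‖ρ (t / n * Y ω)‖ ≤ n * (t / n * Y ω * (C + |b| * |Real.log (t * Y ω)|)) := by
            gcongr
        _ = _ := by field_simp
    · have hd : Integrable (fun ω => C * t * Y ω +
          |b| * |t * (Y ω * Real.log (Y ω)) + t * Real.log t * Y ω|) P :=
        (hYi.const_mul _).add (((hYlog.const_mul t).add (hYi.const_mul _)).abs.const_mul _)
      refine hd.congr ?_
      filter_upwards [hY0] with ω hω
      rcases hω.eq_or_lt with hω | hω
      · simp [← hω]
      rw [show t * (Y ω * Real.log (Y ω)) + t * Real.log t * Y ω = t * Y ω * Real.log (t * Y ω) by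
        rw [Real.log_mul ht.ne' hω.ne']; ring, abs_mul, abs_of_pos (mul_pos ht hω)]
      ring
    · filter_upwards [hY0] with ω hω
      rcases hω.eq_or_lt with hω | hω
      · simp [← hω, hρ, h0]
      have hs : Tendsto (fun n : ℕ => t / n * Y ω) atTop (𝓝[>] 0) := by
        refine tendsto_nhdsWithin_iff.2 ⟨?_, ?_⟩
        · simpa using (tendsto_const_div_atTop_nhds_zero_nat t).mul_const (Y ω)
        · filter_upwards [eventually_gt_atTop 0] with n hn
          have : (0 : ℝ) < n := by exact_mod_cast hn
          exact mul_pos (by positivity) hω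
      have h2 := (h.comp_tendsto hs).norm_left
      have h3 := h2.tendsto_div_nhds_zero.mul_const (t * Y ω)
      rw [zero_mul] at h3
      rw [tendsto_zero_iff_norm_tendsto_zero]
      refine h3.congr' ?_
      filter_upwards [eventually_ne_atTop 0] with n hn
      have : (n : ℝ) ≠ 0 := by exact_mod_cast hn
      simp only [Function.comp, norm_mul, Complex.norm_natCast, hρ]
      field_simp
  rw [integral_zero] at hlim
  refine hlim.congr' ?_
  filter_upwards [eventually_ne_atTop 0] with n hn
  have hn0 : (n : ℂ) ≠ 0 := by exact_mod_cast hn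
  have hpt (ω : Ω) : n * ρ (t / n * Y ω) = n * (φ (t / n * Y ω) - 1) + (w * t * (Y ω : ℝ) +
      (Complex.I * b * t * (Y ω * Real.log (Y ω) : ℝ) +
        Complex.I * b * (t * Real.log t - t * Real.log n : ℝ) * (Y ω : ℝ))) := by
    have := congrArg (fun x : ℝ => (x : ℂ)) (mul_log_div_mul (y := Y ω) ht hn)
    simp only [hρ]
    push_cast at this ⊢
    field_simp at this ⊢
    linear_combination Complex.I * b * this
  have hφi : Integrable (fun ω => φ (t / n * Y ω)) P :=
    Integrable.of_bound (by
      have : Measurable fun ω => φ (t / n * Y ω) := by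
        have := hφ.measurable
        fun_prop
      exact this.aestronglyMeasurable) 1 (ae_of_all _ fun ω => h1 _)
  simp_rw [hpt]
  have i1 : Integrable (fun ω => (n : ℂ) * (φ (t / n * Y ω) - 1)) P :=
    (hφi.sub (integrable_const _)).const_mul _
  have i2 : Integrable (fun ω => w * t * (Y ω : ℂ)) P := hYi.ofReal.const_mul _
  have i3 : Integrable (fun ω => Complex.I * b * t * ((Y ω * Real.log (Y ω) : ℝ) : ℂ)) P :=
    hYlog.ofReal.const_mul _
  have i4 : Integrable (fun ω => Complex.I * b * (t * Real.log t - t * Real.log n : ℝ) *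
    (Y ω : ℂ)) P := hYi.ofReal.const_mul _
  rw [integral_add i1 (i2.fun_add (i3.fun_add i4)), integral_add i2 (i3.fun_add i4),
    integral_add i3 i4]
  simp only [integral_const_mul, integral_complex_ofReal]
  rw [integral_sub hφi (integrable_const _)]
  simp only [integral_const, probReal_univ, one_smul]
  push_cast
  ring

/-! ### Affine images and non-degeneracy -/

lemma charFun_map_mul_sub_const {Ω' : Type*} [MeasurableSpace Ω'] {P' : Measure Ω'} {Z : Ω' → ℝ}
    (hZ : AEMeasurable Z P') (m c t : ℝ) :
    charFun (P'.map fun ω => m * Z ω - c) t =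
      charFun (P'.map Z) (m * t) * Complex.exp (-(Complex.I * (t * c : ℝ))) := by
  have h1 : (P'.map fun ω => m * Z ω - c) = (P'.map fun ω => m * Z ω).map (· + -c) := by
    rw [AEMeasurable.map_map_of_aemeasurable (by fun_prop) (by fun_prop)]
    rfl
  rw [h1, charFun_map_add_const, charFun_map_mul_comp hZ]
  congr 2
  simp
  ring

/-- A probability measure whose characteristic function has modulus `1` is a point mass, since the
difference of two independent variables with this law is almost surely `0`. -/
lemma exists_eq_dirac_of_norm_charFun_eq_one {μ : Measure ℝ} [IsProbabilityMeasure μ]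
    (h : ∀ t, 0 < t → ‖charFun μ t‖ = 1) : ∃ x, μ = Measure.dirac x := by
  have hall (t : ℝ) : ‖charFun μ t‖ = 1 := by
    rcases lt_trichotomy t 0 with ht | rfl | ht
    · rw [← neg_neg t, charFun_neg, RCLike.norm_conj]
      exact h _ (neg_pos.2 ht)
    · simp
    · exact h t ht
  have : IsProbabilityMeasure (μ.map fun x => -1 * x) :=
    Measure.isProbabilityMeasure_map (by fun_prop)
  -- The symmetrized law has characteristic function `|charFun μ|² = 1`.
  have hsym : (μ.prod (μ.map fun x => -1 * x)).map (fun p => p.1 + p.2) = Measure.dirac 0 := by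
    apply Measure.ext_of_charFun
    rw [charFun_map_add_prod_eq_mul]
    ext t
    rw [Pi.mul_apply, charFun_map_mul, neg_one_mul, charFun_neg, Complex.mul_conj', hall]
    simp [charFun_dirac]
  have hae : ∀ᵐ p ∂(μ.prod (μ.map fun x => -1 * x)), p.1 + p.2 = 0 := by
    have h0 : ∀ᵐ y ∂((μ.prod (μ.map fun x => -1 * x)).map fun p => p.1 + p.2), y = 0 := by
      rw [hsym, ae_dirac_eq]
      rfl
    exact ae_of_ae_map (by fun_prop) h0
  obtain ⟨x, hx⟩ := (Measure.ae_ae_of_ae_prod hae).exists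
  refine ⟨x, ?_⟩
  have hx' : (fun y : ℝ => y) =ᵐ[μ] fun _ => x := by
    filter_upwards [ae_of_ae_map (by fun_prop) hx] with y hy
    linarith
  calc μ = μ.map fun y => y := Measure.map_id'.symm
    _ = μ.map fun _ => x := Measure.map_congr hx'
    _ = Measure.dirac x := by simp [Measure.map_const]

/-- The coefficients of `t log t` in the two parametrizations of a `1`-stable characteristic
function agree. -/
lemma mul_eq_of_S1_eq_oneStable {γ c δ κ l b : ℝ}
    (h : ∀ t : ℝ, 0 < t →
      Complex.exp (-((γ * t : ℝ) : ℂ) * (1 + Complex.I * ((c * Real.log t : ℝ) : ℂ))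
        + Complex.I * ((δ * t : ℝ) : ℂ)) =
      Complex.exp (-((κ : ℂ) - Complex.I * (l : ℂ)) * (t : ℂ)
        - Complex.I * ((b * t * Real.log t : ℝ) : ℂ))) : γ * c = b := by
  set D : ℝ → ℂ := fun t => (κ - γ + Complex.I * (δ - l)) * t
    + Complex.I * (b - γ * c) * (t * Real.log t : ℝ) with hD
  have hDc : Continuous D := by
    have := Real.continuous_mul_log
    fun_prop
  have hexp (t : ℝ) (ht : 0 ≤ t) : Complex.exp (D t) = 1 := by
    rcases ht.eq_or_lt with rfl | ht
    · simp [hD]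
    rw [show D t = (-((γ * t : ℝ) : ℂ) * (1 + Complex.I * ((c * Real.log t : ℝ) : ℂ))
        + Complex.I * ((δ * t : ℝ) : ℂ)) - (-((κ : ℂ) - Complex.I * (l : ℂ)) * (t : ℂ)
        - Complex.I * ((b * t * Real.log t : ℝ) : ℂ)) by simp only [hD]; push_cast; ring,
      Complex.exp_sub, h t ht, div_self (Complex.exp_ne_zero _)]
  have hzero (t : ℝ) (ht : 0 ≤ t) : D t = 0 := by
    rw [← Complex.log_exp_eq_of_continuousOn (T := t) hDc.continuousOn (by simp [hD])
      (fun s hs => by simp [hexp s hs.1]) ⟨ht, le_rfl⟩, hexp t ht, Complex.log_one]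
  have h1 := hzero 1 zero_le_one
  -- At `t = 1` the term `t log t` vanishes, which isolates the linear coefficient; `t = e` then
  -- isolates the other one.
  have h2 := hzero (Real.exp 1) (Real.exp_pos 1).le
  simp only [hD, Real.log_one, mul_zero, Complex.ofReal_zero, Complex.ofReal_one, mul_one,
    add_zero] at h1
  simp only [hD, Real.log_exp, mul_one, h1, zero_mul, zero_add] at h2
  have h3 : (b : ℂ) - γ * c = 0 := by
    simpa [Complex.I_ne_zero] using h2
  have h4 : b - γ * c = 0 := by exact_mod_cast h3
  linarith

/-- The limit found for the products is the characteristic function of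
`m * Z - b * (v - m * log m)`. The case `m = 0` is included, where `log 0 = 0` is harmless. -/
lemma oneStable_charFun_affine {f : ℝ → ℂ} {w : ℂ} {b m v t : ℝ} (h0 : f 0 = 1)
    (hf : ∀ t : ℝ, 0 < t → f t = Complex.exp (-w * t - Complex.I * (b * t * Real.log t : ℝ)))
    (hm : 0 ≤ m) (hmv : m = 0 → v = 0) (ht : 0 < t) :
    f (m * t) * Complex.exp (-(Complex.I * (t * (b * (v - m * Real.log m)) : ℝ))) =
      Complex.exp (-(w * (t * m : ℝ) + Complex.I * (b * (t * v + t * Real.log t * m) : ℝ))) := by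
  rcases hm.eq_or_lt with rfl | hm
  · simp [h0, hmv rfl]
  rw [hf _ (mul_pos hm ht), ← Complex.exp_add, Real.log_mul hm.ne' ht.ne']
  congr 1
  push_cast
  ring

/-- A non-degenerate law in the limit of `φ (t / n) ^ n * exp (-i b t log n)` has a characteristic
function of one-stable form, with `w = κ - i l` and `κ > 0`. -/
lemma exists_hasOneStableCharFun {μ : Measure ℝ} [IsProbabilityMeasure μ] {φ : ℝ → ℂ} {b : ℝ}
    (hnd : ∀ x, μ ≠ Measure.dirac x)
    (h : ∀ t : ℝ, Tendsto (fun n : ℕ =>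
      φ (t / n) ^ n * Complex.exp (-(Complex.I * (t * (b * Real.log n) : ℝ))))
      atTop (𝓝 (charFun μ t))) :
    ∃ w : ℂ, 0 < w.re ∧ ∀ t, 0 ≤ t →
      charFun μ t = Complex.exp (-w * t - Complex.I * (b * t * Real.log t : ℝ)) := by
  obtain ⟨w, hw⟩ := exists_one_stable_form (f := charFun μ) (b := b) (by fun_prop) (by simp)
    fun k hk t _ => by
      have hk0 : (k : ℝ) ≠ 0 := by exact_mod_cast hk
      -- The limit along `k * n`, computed in two ways.
      have h1 := (h t).comp (tendsto_id.const_mul_atTop' (Nat.pos_of_ne_zero hk))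
      have h2 := ((h (t / k)).pow k).mul_const
        (Complex.exp (-(Complex.I * (t * (b * Real.log k) : ℝ))))
      refine tendsto_nhds_unique h1 (h2.congr' ?_)
      filter_upwards [eventually_ne_atTop 0] with n hn
      have hn0 : (n : ℝ) ≠ 0 := by exact_mod_cast hn
      have hk0' : (k : ℂ) ≠ 0 := by exact_mod_cast hk
      simp only [Function.comp, id]
      rw [mul_pow, ← pow_mul, ← Complex.exp_nat_mul, mul_assoc, ← Complex.exp_add, mul_comm n k,
        div_div, Nat.cast_mul, Real.log_mul hk0 hn0]
      congr 2
      push_cast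
      field_simp
      ring
  refine ⟨w, ?_, hw⟩
  have hnorm (t : ℝ) (ht : 0 ≤ t) : ‖charFun μ t‖ = Real.exp (-w.re * t) := by
    rw [hw t ht, Complex.norm_exp]
    simp
  have hnonneg : 0 ≤ w.re := by
    have := norm_charFun_le_one (μ := μ) 1
    rw [hnorm 1 zero_le_one, mul_one, Real.exp_le_one_iff] at this
    linarith
  refine hnonneg.lt_of_ne fun h0 => ?_
  obtain ⟨x, hx⟩ := exists_eq_dirac_of_norm_charFun_eq_one (μ := μ) fun t ht => by
    rw [hnorm t ht.le, ← h0]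
    simp
  exact hnd x hx

/-! ### Convergence in distribution -/

/-- Lévy's theorem on the half-line: by conjugation, convergence of the characteristic functions at
positive arguments suffices. -/
lemma tendstoInDistribution_of_tendsto_charFun_pos {Ω : Type*} [MeasurableSpace Ω] {P : Measure Ω}
    [IsProbabilityMeasure P] {Ω' : Type*} [MeasurableSpace Ω'] {P' : Measure Ω'}
    [IsProbabilityMeasure P'] {A : ℕ → Ω → ℝ} {Z : Ω' → ℝ} (hA : ∀ n, AEMeasurable (A n) P)
    (hZ : AEMeasurable Z P')
    (h : ∀ t, 0 < t →
      Tendsto (fun n => charFun (P.map (A n)) t) atTop (𝓝 (charFun (P'.map Z) t))) :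
    TendstoInDistribution A atTop Z (fun _ => P) P' := by
  refine ⟨hA, hZ, ProbabilityMeasure.tendsto_of_tendsto_charFun fun t => ?_⟩
  simp only [ProbabilityMeasure.coe_mk]
  rcases lt_trichotomy t 0 with ht | rfl | ht
  · have := (Complex.continuous_conj.tendsto _).comp (h (-t) (neg_pos.2 ht))
    simpa [Function.comp_def, charFun_neg] using this
  · have (n : ℕ) : IsProbabilityMeasure (P.map (A n)) := Measure.isProbabilityMeasure_map (hA n)
    have : IsProbabilityMeasure (P'.map Z) := Measure.isProbabilityMeasure_map hZ
    simp
  · exact h t ht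

/-- The limit theorem for the products, given the form of the characteristic function of `Z`. -/
lemma tendstoInDistribution_mean_mul {Ω : Type*} [MeasurableSpace Ω] {P : Measure Ω}
    [IsProbabilityMeasure P] {Ω' : Type*} [MeasurableSpace Ω'] {P' : Measure Ω'}
    [IsProbabilityMeasure P'] {X Y : ℕ → Ω → ℝ} {Z : Ω' → ℝ} {b : ℝ} {w : ℂ}
    (hXm : ∀ i, Measurable (X i)) (hXind : iIndepFun X P)
    (hXid : ∀ i, IdentDistrib (X i) (X 0) P P)
    (hYm : ∀ i, Measurable (Y i)) (hYind : iIndepFun Y P)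
    (hYid : ∀ i, IdentDistrib (Y i) (Y 0) P P)
    (hYnonneg : ∀ᵐ ω ∂P, 0 ≤ Y 0 ω)
    (hXY : IndepFun (fun ω i => X i ω) (fun ω i => Y i ω) P)
    (hYlog : Integrable (fun ω => Y 0 ω * Real.log (Y 0 ω)) P)
    (hconv : TendstoInDistribution
      (fun (n : ℕ) ω => (n : ℝ)⁻¹ * ∑ i ∈ Finset.range n, X i ω - b * Real.log n)
      atTop Z (fun _ => P) P')
    (hw : ∀ t : ℝ, 0 ≤ t →
      charFun (P'.map Z) t = Complex.exp (-w * t - Complex.I * (b * t * Real.log t : ℝ)))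
    {m v : ℝ} (hm : m = ∫ ω, Y 0 ω ∂P) (hv : v = ∫ ω, Y 0 ω * Real.log (Y 0 ω) ∂P)
    (hm0 : 0 ≤ m) (hmv : m = 0 → v = 0) :
    TendstoInDistribution
      (fun (n : ℕ) ω => (n : ℝ)⁻¹ * ∑ i ∈ Finset.range n, X i ω * Y i ω - b * m * Real.log n)
      atTop (fun ω => m * Z ω - b * (v - m * Real.log m)) (fun _ => P) P' := by
  have hZm := hconv.aemeasurable_limit
  have : IsProbabilityMeasure (P'.map Z) := Measure.isProbabilityMeasure_map hZm
  have : IsProbabilityMeasure (P.map (X 0)) := Measure.isProbabilityMeasure_map (hXm 0).aemeasurable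
  have hpair (i : ℕ) : IndepFun (X i) (Y i) P :=
    hXY.comp (φ := fun f : ℕ → ℝ => f i) (ψ := fun f : ℕ → ℝ => f i) (by fun_prop) (by fun_prop)
  have hWid (i : ℕ) : IdentDistrib (fun ω => X i ω * Y i ω) (fun ω => X 0 ω * Y 0 ω) P P :=
    ((hXid i).prodMk (hYid i) (hpair i) (hpair 0)).comp
      (u := fun p : ℝ × ℝ => p.1 * p.2) (by fun_prop)
  have hWm (i : ℕ) : Measurable fun ω => X i ω * Y i ω := (hXm i).mul (hYm i)
  have hexpansion := isLittleO_sub_one_add (φ := charFun (P.map (X 0))) (b := b) (w := w)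
    (by fun_prop) (by simp) fun t ht => by
      rw [← hw t ht.1]
      simpa only [charFun_map_mean_sub_const hXm hXind hXid] using
        tendsto_charFun_atTop_prod_nhds hconv t
  refine tendstoInDistribution_of_tendsto_charFun_pos (fun n => ?_) (by fun_prop) fun t ht => ?_
  · exact (((Finset.measurable_fun_sum _ fun i _ => hWm i).const_mul _).sub_const _).aemeasurable
  rw [charFun_map_mul_sub_const hZm, oneStable_charFun_affine (w := w) (by simp)
    (fun t ht => hw t ht.le) hm0 hmv ht]
  have hlim := tendsto_natCast_mul_integral_sub_one (hYm 0) hYnonneg hYlog (by fun_prop)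
    (by simp) norm_charFun_le_one hexpansion ht
  rw [← hm, ← hv] at hlim
  refine (tendsto_pow_mul_exp_of_tendsto hlim).congr fun n => ?_
  rw [charFun_map_mean_sub_const hWm (iIndepFun.mul_of_indepFun hXm hXind hYm hYind hXY) hWid,
    charFun_map_mul_eq_integral (hXm 0) (hYm 0) (hpair 0)]
  congr 4
  push_cast
  ring

lemma IsS1Law.map_affine {Ω' : Type*} [MeasurableSpace Ω'] {P' : Measure Ω'} {Z : Ω' → ℝ}
    [IsProbabilityMeasure P'] (hZ : AEMeasurable Z P') {b κ l m v γ β δ : ℝ} (hm : 0 < m)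
    (hform : HasOneStableCharFun (P'.map Z) κ l b) (h : IsS1Law (P'.map Z) γ β δ) :
    IsS1Law (P'.map fun ω => m * Z ω - b * (v - m * Real.log m)) (m * γ) β (m * δ - b * v) := by
  obtain ⟨_, hγ, hβ, hβ', hchar⟩ := h
  refine ⟨Measure.isProbabilityMeasure_map (by fun_prop), mul_pos hm hγ, hβ, hβ', fun t => ?_⟩
  have hb : γ * (β * (2 / Real.pi)) = b := mul_eq_of_S1_eq_oneStable (δ := δ) fun t ht => by
    rw [← hform t ht, hchar t, abs_of_pos ht, Real.sign_of_pos ht, mul_one]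
  rw [charFun_map_mul_sub_const hZ, hchar, ← Complex.exp_add]
  congr 1
  rcases eq_or_ne t 0 with rfl | ht
  · simp
  have hsign : Real.sign (m * t) = Real.sign t := by
    rcases lt_or_gt_of_ne ht with ht | ht
    · rw [Real.sign_of_neg ht, Real.sign_of_neg (mul_neg_of_pos_of_neg hm ht)]
    · rw [Real.sign_of_pos ht, Real.sign_of_pos (mul_pos hm ht)]
  have habs : |t| * Real.sign t = t := by
    rcases lt_or_gt_of_ne ht with ht | ht
    · rw [Real.sign_of_neg ht, abs_of_neg ht]; ring
    · rw [Real.sign_of_pos ht, abs_of_pos ht]; ring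
  rw [hsign, abs_mul, abs_of_pos hm, Real.log_mul hm.ne' (abs_ne_zero.2 ht)]
  have hreal : γ * (m * |t|) * (β * (2 / Real.pi) * Real.sign t * Real.log m) =
      t * (b * (m * Real.log m)) := by
    rw [← hb]
    linear_combination (γ * m * β * (2 / Real.pi) * Real.log m) * habs
  have hcomplex := congrArg (fun x : ℝ => (x : ℂ)) hreal
  push_cast at hcomplex ⊢
  linear_combination -Complex.I * hcomplex
theorem mainTheorem4
    {Ω : Type*} [MeasurableSpace Ω] (P : Measure Ω) [IsProbabilityMeasure P]
    {Ω' : Type*} [MeasurableSpace Ω'] (P' : Measure Ω') [IsProbabilityMeasure P']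
    (X Y : ℕ → Ω → ℝ) (Z : Ω' → ℝ) (b : ℝ)
    -- `X 0, X 1, …` are i.i.d.
    (hXm : ∀ i, Measurable (X i)) (hXind : iIndepFun X P)
    (hXid : ∀ i, IdentDistrib (X i) (X 0) P P)
    -- `Y 0, Y 1, …` are i.i.d., nonnegative
    (hYm : ∀ i, Measurable (Y i)) (hYind : iIndepFun Y P)
    (hYid : ∀ i, IdentDistrib (Y i) (Y 0) P P)
    (hYnonneg : ∀ᵐ ω ∂P, 0 ≤ Y 0 ω)
    -- the two sequences are independent of each other
    (hXY : IndepFun (fun ω i => X i ω) (fun ω i => Y i ω) P)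
    (hYlog : Integrable (fun ω => Y 0 ω * Real.log (Y 0 ω)) P)
    (hZ : IsStableLaw 1 (P'.map Z))
    (hconv : TendstoInDistribution
      (fun (n : ℕ) ω => (n : ℝ)⁻¹ * ∑ i ∈ Finset.range n, X i ω - b * Real.log n)
      atTop Z (fun _ => P) P')
    (m v : ℝ) (hm : m = ∫ ω, Y 0 ω ∂P) (hv : v = ∫ ω, Y 0 ω * Real.log (Y 0 ω) ∂P)
    (Z' : Ω' → ℝ) (hZ' : Z' = fun ω => m * Z ω - b * (v - m * Real.log m)) :
    Integrable (Y 0) P ∧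
    TendstoInDistribution
      (fun (n : ℕ) ω => (n : ℝ)⁻¹ * ∑ i ∈ Finset.range n, X i ω * Y i ω - b * m * Real.log n)
      atTop Z' (fun _ => P) P' ∧
    (∃ κ l : ℝ, 0 < κ ∧ HasOneStableCharFun (P'.map Z) κ l b) ∧
    (∀ κ l : ℝ, HasOneStableCharFun (P'.map Z) κ l b →
      ∀ t : ℝ, 0 < t → charFun (P'.map Z') t =
        Complex.exp (-((m * κ : ℝ) + Complex.I * ((b * v - m * l : ℝ) : ℂ)) * (t : ℂ)
          - Complex.I * ((b * m * t * Real.log t : ℝ) : ℂ))) ∧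
    (∀ γ β δ : ℝ, IsS1Law (P'.map Z) γ β δ → 0 < m →
      IsS1Law (P'.map Z') (m * γ) β (m * δ - b * v)) := by
  subst hZ'
  have hZm := hconv.aemeasurable_limit
  have hprob : IsProbabilityMeasure (P'.map Z) := Measure.isProbabilityMeasure_map hZm
  have hYi := integrable_of_integrable_mul_log (hYm 0).aestronglyMeasurable hYnonneg hYlog
  have hm0 : 0 ≤ m := hm ▸ integral_nonneg_of_ae hYnonneg
  have hmv : m = 0 → v = 0 := fun h => by
    rw [hm, integral_eq_zero_iff_of_nonneg_ae hYnonneg hYi] at h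
    rw [hv]
    refine integral_eq_zero_of_ae ?_
    filter_upwards [h] with ω hω
    simp [hω]
  obtain ⟨-, -, _, _, ⟨-, hnd, -⟩, -⟩ := hZ
  obtain ⟨w, hwpos, hw⟩ := exists_hasOneStableCharFun (φ := charFun (P.map (X 0))) (b := b) hnd
    fun t => by
      simpa only [charFun_map_mean_sub_const hXm hXind hXid, Function.comp_def, id] using
        (tendsto_charFun_atTop_prod_nhds hconv t).comp
          (tendsto_id.prodMk (tendsto_const_nhds (x := t)))
  have hform : HasOneStableCharFun (P'.map Z) w.re (-w.im) b := fun t ht => by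
    rw [hw t ht.le]
    congr 3
    apply Complex.ext <;> simp
  refine ⟨hYi, tendstoInDistribution_mean_mul hXm hXind hXid hYm hYind hYid hYnonneg hXY hYlog
    hconv hw hm hv hm0 hmv, ⟨w.re, -w.im, hwpos, hform⟩, fun κ l h t ht => ?_,
    fun γ β δ h hmpos => h.map_affine hZm hmpos hform⟩
  rw [charFun_map_mul_sub_const hZm, oneStable_charFun_affine (w := κ - Complex.I * l) (by simp)
    h hm0 hmv ht]
  congr 1
  push_cast
  ring
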